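/- Let $H\neq\{0\}$ be a complex Hilbert space and let $B(H)$ be the algebra of bounded linear operators on $H$. A \emph{resolution of identity} on a locally compact Hausdorff space $\Omega\neq\emptyset$, acting on $H$, is a map $P$ from the Borel $\sigma$-algebra of $\Omega$ to $B(H)$ such that (i) each $P(\omega)$ is an orthogonal projection, (ii) $P(\Omega)=1$, and (iii) for every $x\in H$, the function $\omega\mapsto\langle P(\omega)x,x\rangle=\|P(\omega)x\|^2$ is a measure that is inner regular, i.e. its value at each Borel set $\omega$ is the supremum of its values at the compact subsets of $\omega$. For a Borel step function $h=\sum_{\omega\in D}\alpha_\omega 1_\omega$ with $D$ a finite Borel partition of $\Omega$, put $I_P(h)=\sum_{\omega\in D}\alpha_\omega P(\omega)$. For a bounded Borel function $f:\Omega\to\mathbb C$ and $a\in B(H)$, one writes $a=\int f\,dP$ (in norm) if $\|a-I_P(h)\|\le\sup_{z\in\Omega}|f(z)-h(z)|$ for every Borel step function $h$. If there is a largest open set $\omega\subset\Omega$ with $P(\omega)=0$, then $\Omega\setminus\omega$ is called the \emph{support} of $P$. For $S\subset B(H)$, let $S'$ denote the set of all operators in $B(H)$ that commute with every element of $S$,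 and put $P'=\{P(\omega):\omega\subset\Omega\text{ Borel}\}'$. \textbf{Theorem (Spectral Theorem for normal bounded linear operators).} Let $b$ be a normal bounded linear operator on $H$, with spectrum $\mathrm{sp}(b)$. Then there is a unique resolution of identity $P$ on $\mathrm{sp}(b)$, acting on $H$, such that $$b=\int_{\mathrm{sp}(b)} z\,dP(z)\quad\text{(in norm)}.$$ Moreover, $\{b\}'=P'$, and the support of $P$ exists and is all of $\mathrm{sp}(b)$. -/

import Mathlib

open MeasureTheory Function

noncomputable section

/-- A spectral measure on the σ-algebra of the measurable space `Ω`, acting on the Hilbert space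
`H`: a projection-valued map `P` on the measurable sets with `P Ω = 1` such that, for every `x`,
`ω ↦ ⟨P ω x, x⟩ = ‖P ω x‖ ^ 2` is a measure.  As for Mathlib's vector measures, the irrelevant
values at non-measurable sets are fixed to be `0`, so that a spectral measure is determined by its
values on the measurable sets. -/
@[ext]
structure SpectralMeasure (Ω : Type*) [MeasurableSpace Ω] (H : Type*) [NormedAddCommGroup H]
    [InnerProductSpace ℂ H] [CompleteSpace H] where
  toFun : Set Ω → H →L[ℂ] H
  not_measurable : ∀ ω, ¬ MeasurableSet ω → toFun ω = 0
  isStarProjection : ∀ ω, MeasurableSet ω → IsStarProjection (toFun ω)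
  univ : toFun Set.univ = 1
  hasSum_iUnion : ∀ (x : H) (ω : ℕ → Set Ω), (∀ i, MeasurableSet (ω i)) →
    Pairwise (Disjoint on ω) →
    HasSum (fun i => ‖toFun (ω i) x‖ ^ 2) (‖toFun (⋃ i, ω i) x‖ ^ 2)

namespace SpectralMeasure

section

variable {Ω : Type*} [MeasurableSpace Ω] {H : Type*} [NormedAddCommGroup H]
  [InnerProductSpace ℂ H] [CompleteSpace H]

instance : CoeFun (SpectralMeasure Ω H) (fun _ => Set Ω → H →L[ℂ] H) := ⟨SpectralMeasure.toFun⟩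

theorem empty (P : SpectralMeasure Ω H) : P ∅ = 0 := by
  ext x
  have h := P.hasSum_iUnion x (fun _ => ∅) (fun _ => MeasurableSet.empty)
    (fun _ _ _ => disjoint_bot_left)
  have h0 := h.summable.tendsto_atTop_zero
  have h1 := tendsto_nhds_unique h0 tendsto_const_nhds
  simpa using h1.symm

theorem inner_apply_self (P : SpectralMeasure Ω H) (ω : Set Ω) (x : H) :
    inner ℂ (P ω x) x = ((‖P ω x‖ ^ 2 : ℝ) : ℂ) := by
  by_cases hω : MeasurableSet ω
  · have h := P.isStarProjection ω hω
    have h1 : P ω (P ω x) = P ω x := congrArg (fun a : H →L[ℂ] H => a x) h.isIdempotentElem.eq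
    have h2 : ContinuousLinearMap.adjoint (P ω) = P ω := h.isSelfAdjoint
    have h3 : inner ℂ (P ω x) (P ω x) = inner ℂ (P ω x) x := by
      conv_lhs => rw [← ContinuousLinearMap.adjoint_inner_left, h2, h1]
    rw [← h3, inner_self_eq_norm_sq_to_K]
    norm_cast
  · simp [P.not_measurable ω hω]

/-- The measure `⟨P x, x⟩ : ω ↦ ⟨P ω x, x⟩ = ‖P ω x‖ ^ 2`. -/
def scalarMeasure (P : SpectralMeasure Ω H) (x : H) : Measure Ω :=
  Measure.ofMeasurable (fun ω _ => ENNReal.ofReal (‖P ω x‖ ^ 2))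
    (by simp [P.empty])
    (fun ω hω hd => by
      have h := P.hasSum_iUnion x ω hω hd
      rw [← h.tsum_eq, ENNReal.ofReal_tsum_of_nonneg (fun _ => by positivity) h.summable])

theorem scalarMeasure_apply (P : SpectralMeasure Ω H) (x : H) {ω : Set Ω}
    (hω : MeasurableSet ω) : P.scalarMeasure x ω = ENNReal.ofReal (‖P ω x‖ ^ 2) :=
  Measure.ofMeasurable_apply ω hω

/-- The set of operators `{P ω : ω measurable}`. -/
def operators (P : SpectralMeasure Ω H) : Set (H →L[ℂ] H) :=
  {a | ∃ ω, MeasurableSet ω ∧ P ω = a}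

/-- The integral `I_P h = ∑ α • P {h = α}` of a step function `h` with respect to `P`. -/
def stepIntegral (P : SpectralMeasure Ω H) (h : SimpleFunc Ω ℂ) : H →L[ℂ] H :=
  ∑ α ∈ h.range, α • P (h ⁻¹' {α})

/-- `a = ∫ f dP` in norm, for a bounded measurable function `f`: one has
`‖a - I_P h‖ ≤ |f - h|_∞` for every step function `h`, where `|·|_∞` is the supremum norm. -/
def IsNormIntegral (P : SpectralMeasure Ω H) (f : Ω → ℂ) (a : H →L[ℂ] H) : Prop :=
  Measurable f ∧ BddAbove (Set.range fun z => ‖f z‖) ∧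
    ∀ h : SimpleFunc Ω ℂ, ‖a - P.stepIntegral h‖ ≤ ⨆ z, ‖f z - h z‖

end

end SpectralMeasure

/-- A resolution of identity on a locally compact Hausdorff space `Ω`, acting on `H`: a spectral
measure on the Borel σ-algebra of `Ω` such that all the measures `⟨P x, x⟩` are inner regular with
respect to compact sets. -/
@[ext]
structure ResolutionOfIdentity (Ω : Type*) [TopologicalSpace Ω] [LocallyCompactSpace Ω]
    [T2Space Ω] [MeasurableSpace Ω] [BorelSpace Ω] (H : Type*) [NormedAddCommGroup H]
    [InnerProductSpace ℂ H] [CompleteSpace H] extends SpectralMeasure Ω H where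
  innerRegular : ∀ x : H, (toSpectralMeasure.scalarMeasure x).InnerRegular

/-- `S` is the support of `P`: there is a largest open set `ω` with `P ω = 0`, and `S` is its
complement. -/
def ResolutionOfIdentity.HasSupport {Ω : Type*} [TopologicalSpace Ω] [LocallyCompactSpace Ω]
    [T2Space Ω] [MeasurableSpace Ω] [BorelSpace Ω] {H : Type*} [NormedAddCommGroup H]
    [InnerProductSpace ℂ H] [CompleteSpace H] (P : ResolutionOfIdentity Ω H) (S : Set Ω) : Prop :=
  ∃ ω : Set Ω, IsGreatest {U : Set Ω | IsOpen U ∧ P.toSpectralMeasure U = 0} ω ∧ S = ωᶜ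

end

/-!
A spectral measure `P` on a compact Hausdorff space `X` defines the representation `f ↦ ∫ f dP` of
the C⋆-algebra `C(X, ℂ)`. Conversely, let `Φ` be a representation of `C(X, ℂ)`. For every vector
`x` the functional `f ↦ ⟨Φ f x, x⟩` is positive, hence is integration against a Radon measure `μ_x`,
and since `∫ |g|² dμ_x = ‖Φ g x‖²`, the map `g ↦ Φ g x` extends to an isometry of `L²(μ_x)` into
`H`. The images of the indicator functions under these isometries are pointwise limits of the
operators `Φ g`; they are therefore linear in `x`, commute with everything that commutes with `Φ`,
and make up a resolution of identity. The two constructions are inverse to each other, because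
Radon measures are determined by the integrals of continuous functions.

For a normal operator `b` and `X = sp(b)`, the condition `b = ∫ z dP(z)` says that the
representation of `P` sends the inclusion of `sp(b)` into `ℂ` to `b`, i.e. that it is the continuous
functional calculus of `b`. Existence and uniqueness of `P` are thus one statement; the commutant of
the functional calculus is that of `b` by Fuglede's theorem, and its injectivity forces the support
of `P` to be full.
-/

open scoped InnerProductSpace ComplexConjugate CompactlySupported Topology
open Filter

noncomputable section

section Operators

variable {H : Type*} [NormedAddCommGroup H] [InnerProductSpace ℂ H]

theorem eq_of_forall_inner_apply_eq {S T : H →L[ℂ] H} (h : ∀ x, ⟪x, S x⟫_ℂ = ⟪x, T x⟫_ℂ) :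
    S = T :=
  ContinuousLinearMap.coe_injective <| (ext_inner_map _ _).1 fun x => by
    rw [ContinuousLinearMap.coe_coe, ContinuousLinearMap.coe_coe, ← inner_conj_symm, h,
      inner_conj_symm]

variable [CompleteSpace H]

theorem inner_star_mul_self_apply (T : H →L[ℂ] H) (x : H) :
    ⟪x, (star T * T) x⟫_ℂ = ((‖T x‖ ^ 2 : ℝ) : ℂ) := by
  rw [mul_apply_eq_comp, ContinuousLinearMap.star_eq_adjoint,
    ContinuousLinearMap.adjoint_inner_right, inner_self_eq_norm_sq_to_K]
  norm_cast

theorem isStarProjection_of_forall_inner_apply_eq {T : H →L[ℂ] H}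
    (h : ∀ x, ⟪x, T x⟫_ℂ = ((‖T x‖ ^ 2 : ℝ) : ℂ)) : IsStarProjection T := by
  have hT : star T * T = T := eq_of_forall_inner_apply_eq fun x => by
    rw [inner_star_mul_self_apply, h]
  have hstar : star T = T := by rw [← hT, star_mul, star_star]
  exact ⟨by rwa [hstar] at hT, hstar⟩

end Operators

section UniformLimits

theorem tendstoUniformlyOn_nearestPt {E : Type*} [PseudoMetricSpace E] [MeasurableSpace E]
    [OpensMeasurableSpace E] {e : ℕ → E} (he : DenseRange e) {K : Set E} (hK : IsCompact K) :
    TendstoUniformlyOn (fun n => ⇑(SimpleFunc.nearestPt e n)) id atTop K := by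
  refine Metric.tendstoUniformlyOn_iff.2 fun ε hε => ?_
  obtain ⟨t, ht⟩ := hK.elim_finite_subcover (fun n => Metric.ball (e n) ε)
    (fun n => Metric.isOpen_ball) fun w _ =>
      Set.mem_iUnion.2 (he.exists_dist_lt w hε)
  filter_upwards [eventually_ge_atTop (t.sup id)] with n hn w hw
  obtain ⟨k, hk, hwk⟩ := Set.mem_iUnion₂.1 (ht hw)
  have hle := SimpleFunc.edist_nearestPt_le e w ((Finset.le_sup (f := id) hk).trans hn)
  rw [← edist_lt_ofReal, edist_comm]
  rw [Metric.mem_ball', ← edist_lt_ofReal] at hwk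
  exact hle.trans_lt hwk

theorem exists_simpleFunc_tendstoUniformly {Ω E : Type*} [MeasurableSpace Ω]
    [SeminormedAddCommGroup E] [ProperSpace E] [MeasurableSpace E] [OpensMeasurableSpace E]
    {f : Ω → E} (hf : Measurable f) (hb : BddAbove (Set.range fun z => ‖f z‖)) :
    ∃ h : ℕ → SimpleFunc Ω E, TendstoUniformly (fun n => ⇑(h n)) f atTop := by
  obtain ⟨C, hC⟩ := hb
  refine ⟨fun n => (SimpleFunc.nearestPt (TopologicalSpace.denseSeq E) n).comp f hf, ?_⟩
  have hu := (tendstoUniformlyOn_nearestPt (TopologicalSpace.denseRange_denseSeq E)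
    (isCompact_closedBall (0 : E) C)).comp f
  rwa [Set.preimage_eq_univ_iff.2 (by
    rintro _ ⟨z, rfl⟩
    exact mem_closedBall_zero_iff.2 (hC ⟨z, rfl⟩)), tendstoUniformlyOn_univ] at hu

variable {ι Ω E : Type*} {l : Filter ι}

theorem eventually_forall_norm_le_of_tendstoUniformly [SeminormedAddCommGroup E]
    {F : ι → Ω → E} {f : Ω → E} {C : ℝ} (hF : TendstoUniformly F f l) (hf : ∀ z, ‖f z‖ ≤ C) :
    ∀ᶠ n in l, ∀ z, ‖F n z‖ ≤ C + 1 := by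
  filter_upwards [Metric.tendstoUniformly_iff.1 hF 1 one_pos] with n hn z
  have hz : ‖F n z - f z‖ < 1 := by rw [← dist_eq_norm']; exact hn z
  exact (norm_le_norm_add_norm_sub' _ _).trans (add_le_add (hf z) hz.le)

theorem bddAbove_range_norm_of_tendstoUniformly [SeminormedAddCommGroup E] [l.NeBot]
    {F : ι → Ω → E} {f : Ω → E} (hF : TendstoUniformly F f l)
    (hb : ∀ n, BddAbove (Set.range fun z => ‖F n z‖)) : BddAbove (Set.range fun z => ‖f z‖) := by
  obtain ⟨n, hn⟩ := (Metric.tendstoUniformly_iff.1 hF 1 one_pos).exists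
  obtain ⟨C, hC⟩ := hb n
  refine ⟨C + 1, Set.forall_mem_range.2 fun z => ?_⟩
  have hz : ‖f z - F n z‖ < 1 := by rw [← dist_eq_norm]; exact hn z
  exact (norm_le_norm_add_norm_sub' _ _).trans (add_le_add (hC ⟨z, rfl⟩) hz.le)

theorem tendstoUniformly_mul_of_bddAbove [SeminormedRing E] [ProperSpace E] {F G : ι → Ω → E}
    {f g : Ω → E} (hF : TendstoUniformly F f l) (hG : TendstoUniformly G g l)
    (hf : BddAbove (Set.range fun z => ‖f z‖)) (hg : BddAbove (Set.range fun z => ‖g z‖)) :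
    TendstoUniformly (fun n z => F n z * G n z) (fun z => f z * g z) l := by
  obtain ⟨C, hC⟩ := hf
  obtain ⟨D, hD⟩ := hg
  rw [mem_upperBounds, Set.forall_mem_range] at hC hD
  have hmul : UniformContinuousOn (fun p : E × E => p.1 * p.2)
      (Metric.closedBall 0 (C + 1) ×ˢ Metric.closedBall 0 (D + 1)) :=
    ((isCompact_closedBall _ _).prod (isCompact_closedBall _ _)).uniformContinuousOn_of_continuous
      continuous_mul.continuousOn
  have hFG : TendstoUniformly (fun n z => (F n z, G n z)) (fun z => (f z, g z)) l :=
    fun u hu => (hF.prodMk hG u hu).diag_of_prod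
  refine hmul.comp_tendstoUniformly_eventually ?_ (fun z => ?_) hFG
  · filter_upwards [eventually_forall_norm_le_of_tendstoUniformly hF hC,
      eventually_forall_norm_le_of_tendstoUniformly hG hD] with n hFn hGn z
    exact ⟨mem_closedBall_zero_iff.2 (hFn z), mem_closedBall_zero_iff.2 (hGn z)⟩
  · exact ⟨mem_closedBall_zero_iff.2 ((hC z).trans (by linarith)),
      mem_closedBall_zero_iff.2 ((hD z).trans (by linarith))⟩

end UniformLimits

namespace SpectralMeasure

variable {Ω : Type*} [MeasurableSpace Ω] {H : Type*} [NormedAddCommGroup H]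
  [InnerProductSpace ℂ H] [CompleteSpace H]

section ScalarMeasure

instance (P : SpectralMeasure Ω H) (x : H) : IsFiniteMeasure (P.scalarMeasure x) :=
  ⟨by rw [scalarMeasure_apply _ _ MeasurableSet.univ]; exact ENNReal.ofReal_lt_top⟩

theorem scalarMeasure_real_apply (P : SpectralMeasure Ω H) (x : H) {s : Set Ω}
    (hs : MeasurableSet s) : (P.scalarMeasure x).real s = ‖P s x‖ ^ 2 := by
  rw [Measure.real, scalarMeasure_apply _ _ hs, ENNReal.toReal_ofReal (by positivity)]

theorem scalarMeasure_real_univ (P : SpectralMeasure Ω H) (x : H) :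
    (P.scalarMeasure x).real Set.univ = ‖x‖ ^ 2 := by
  rw [scalarMeasure_real_apply _ _ MeasurableSet.univ, P.univ, one_apply_eq_self]

theorem inner_apply_eq_scalarMeasure_real (P : SpectralMeasure Ω H) {s : Set Ω}
    (hs : MeasurableSet s) (x : H) :
    ⟪x, P s x⟫_ℂ = (((P.scalarMeasure x).real s : ℝ) : ℂ) := by
  rw [← inner_conj_symm, inner_apply_self, Complex.conj_ofReal, scalarMeasure_real_apply _ _ hs]

theorem ext_scalarMeasure {P Q : SpectralMeasure Ω H}
    (h : ∀ x, P.scalarMeasure x = Q.scalarMeasure x) : P = Q := by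
  ext1
  funext s
  by_cases hs : MeasurableSet s
  · refine eq_of_forall_inner_apply_eq fun x => ?_
    rw [inner_apply_eq_scalarMeasure_real _ hs, inner_apply_eq_scalarMeasure_real _ hs, h]
  · rw [P.not_measurable s hs, Q.not_measurable s hs]

end ScalarMeasure

section Products

theorem apply_union (P : SpectralMeasure Ω H) {s t : Set Ω} (hs : MeasurableSet s)
    (ht : MeasurableSet t) (hst : Disjoint s t) : P (s ∪ t) = P s + P t :=
  eq_of_forall_inner_apply_eq fun x => by
    rw [add_apply, inner_add_right, inner_apply_eq_scalarMeasure_real _ hs,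
      inner_apply_eq_scalarMeasure_real _ ht, inner_apply_eq_scalarMeasure_real _ (hs.union ht),
      measureReal_union hst ht, Complex.ofReal_add]

theorem mul_eq_zero_of_disjoint (P : SpectralMeasure Ω H) {s t : Set Ω} (hs : MeasurableSet s)
    (ht : MeasurableSet t) (hst : Disjoint s t) : P s * P t = 0 := by
  have hP {u : Set Ω} (hu : MeasurableSet u) : IsIdempotentElem (P u) :=
    (P.isStarProjection u hu).isIdempotentElem
  have hsum := hP (hs.union ht)
  rw [P.apply_union hs ht hst] at hsum
  have : IsAddTorsionFree (H →L[ℂ] H) := .of_isTorsionFree ℂ _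
  exact (hP hs).mul_eq_zero_of_anticommute (((hP hs).add_iff (hP ht)).1 hsum)

theorem apply_inter (P : SpectralMeasure Ω H) {s t : Set Ω} (hs : MeasurableSet s)
    (ht : MeasurableSet t) : P (s ∩ t) = P s * P t := by
  have hst := hs.inter ht
  have hd_left : Disjoint (s ∩ t) (s \ t) :=
    Set.disjoint_sdiff_right.mono_left Set.inter_subset_right
  have hd_right : Disjoint (s ∩ t) (t \ s) :=
    Set.disjoint_sdiff_right.mono_left Set.inter_subset_left
  have hd : Disjoint (s \ t) (t \ s) := disjoint_sdiff_sdiff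
  have hs_eq : P s = P (s ∩ t) + P (s \ t) := by
    rw [← P.apply_union hst (hs.diff ht) hd_left, Set.inter_union_sdiff]
  have ht_eq : P t = P (s ∩ t) + P (t \ s) := by
    rw [← P.apply_union hst (ht.diff hs) hd_right, Set.inter_comm, Set.inter_union_sdiff]
  rw [hs_eq, ht_eq, add_mul, mul_add, mul_add, (P.isStarProjection _ hst).isIdempotentElem.eq,
    P.mul_eq_zero_of_disjoint hst (ht.diff hs) hd_right,
    P.mul_eq_zero_of_disjoint (hs.diff ht) hst hd_left.symm,
    P.mul_eq_zero_of_disjoint (hs.diff ht) (ht.diff hs) hd]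
  simp only [add_zero]

end Products

section StepIntegral

theorem stepIntegral_eq_setToSimpleFunc (P : SpectralMeasure Ω H) (h : SimpleFunc Ω ℂ) :
    P.stepIntegral h = SimpleFunc.setToSimpleFunc (fun s =>
      ((ContinuousLinearMap.id ℂ ℂ).smulRight (P s)).restrictScalars ℝ) h := rfl

-- With respect to the zero measure every set has finite measure and every function is integrable,
-- so no side conditions remain in the lemmas on `SimpleFunc.setToSimpleFunc`.
theorem finMeasAdditive_smulRight (P : SpectralMeasure Ω H) :
    FinMeasAdditive (0 : Measure Ω) (fun s =>
      ((ContinuousLinearMap.id ℂ ℂ).smulRight (P s)).restrictScalars ℝ) := by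
  intro s t hs ht _ _ hst
  ext1
  simp [P.apply_union hs ht hst]

theorem stepIntegral_add (P : SpectralMeasure Ω H) (h k : SimpleFunc Ω ℂ) :
    P.stepIntegral (h + k) = P.stepIntegral h + P.stepIntegral k :=
  SimpleFunc.setToSimpleFunc_add _ P.finMeasAdditive_smulRight
    integrable_zero_measure integrable_zero_measure

theorem stepIntegral_sub (P : SpectralMeasure Ω H) (h k : SimpleFunc Ω ℂ) :
    P.stepIntegral (h - k) = P.stepIntegral h - P.stepIntegral k :=
  SimpleFunc.setToSimpleFunc_sub _ P.finMeasAdditive_smulRight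
    integrable_zero_measure integrable_zero_measure

theorem stepIntegral_piecewise (P : SpectralMeasure Ω H) {s : Set Ω} (hs : MeasurableSet s)
    (c : ℂ) : P.stepIntegral (SimpleFunc.piecewise s hs (SimpleFunc.const _ c)
      (SimpleFunc.const _ 0)) = c • P s := by
  rw [stepIntegral_eq_setToSimpleFunc, SimpleFunc.setToSimpleFunc_indicator _ _ hs]
  · simp
  · ext1; simp [P.empty]

theorem stepIntegral_const (P : SpectralMeasure Ω H) (c : ℂ) :
    P.stepIntegral (SimpleFunc.const _ c) = c • (1 : H →L[ℂ] H) := by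
  rw [← P.univ, ← P.stepIntegral_piecewise MeasurableSet.univ c, SimpleFunc.piecewise_univ]

theorem stepIntegral_mul (P : SpectralMeasure Ω H) (h k : SimpleFunc Ω ℂ) :
    P.stepIntegral (h * k) = P.stepIntegral h * P.stepIntegral k := by
  classical
  induction h using SimpleFunc.induction with
  | add _ h₁ h₂ => rw [add_mul, stepIntegral_add, stepIntegral_add, h₁, h₂, add_mul]
  | @const c s hs =>
    induction k using SimpleFunc.induction with
    | add _ k₁ k₂ => rw [mul_add, stepIntegral_add, stepIntegral_add, k₁, k₂, mul_add]
    | @const d t ht =>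
      rw [P.stepIntegral_piecewise hs, P.stepIntegral_piecewise ht, smul_mul_smul_comm,
        ← P.apply_inter hs ht, ← P.stepIntegral_piecewise (hs.inter ht)]
      congr 1
      ext z
      by_cases hzs : z ∈ s <;> by_cases hzt : z ∈ t <;> simp [hzs, hzt]

theorem stepIntegral_map_conj (P : SpectralMeasure Ω H) (h : SimpleFunc Ω ℂ) :
    P.stepIntegral (h.map conj) = star (P.stepIntegral h) := by
  classical
  induction h using SimpleFunc.induction with
  | @add h k _ hh hk =>
    rw [stepIntegral_add, star_add, ← hh, ← hk, ← stepIntegral_add]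
    congr 1
    ext z
    simp
  | @const c s hs =>
    rw [P.stepIntegral_piecewise hs, star_smul, (P.isStarProjection s hs).isSelfAdjoint.star_eq,
      ← P.stepIntegral_piecewise hs]
    congr 1
    ext z
    by_cases hz : z ∈ s <;> simp [hz]

theorem inner_stepIntegral_apply (P : SpectralMeasure Ω H) (h : SimpleFunc Ω ℂ) (x : H) :
    ⟪x, P.stepIntegral h x⟫_ℂ = ∫ z, h z ∂P.scalarMeasure x := by
  rw [SimpleFunc.integral_eq_sum _ (SimpleFunc.integrable_of_isFiniteMeasure h), stepIntegral,
    sum_apply, inner_sum]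
  refine Finset.sum_congr rfl fun α _ => ?_
  rw [smul_apply, inner_smul_right,
    P.inner_apply_eq_scalarMeasure_real (h.measurableSet_fiber α), Complex.real_smul, mul_comm]

theorem norm_stepIntegral_apply_sq (P : SpectralMeasure Ω H) (h : SimpleFunc Ω ℂ) (x : H) :
    ‖P.stepIntegral h x‖ ^ 2 = ∫ z, ‖h z‖ ^ 2 ∂P.scalarMeasure x := by
  apply Complex.ofReal_injective
  rw [← inner_star_mul_self_apply, ← stepIntegral_map_conj, ← stepIntegral_mul,
    inner_stepIntegral_apply, ← integral_complex_ofReal]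
  congr 1 with z
  simp [Complex.conj_mul']

theorem norm_stepIntegral_le (P : SpectralMeasure Ω H) {h : SimpleFunc Ω ℂ} {C : ℝ} (hC : 0 ≤ C)
    (hh : ∀ z, ‖h z‖ ≤ C) : ‖P.stepIntegral h‖ ≤ C := by
  refine ContinuousLinearMap.opNorm_le_bound _ hC fun x => ?_
  rw [← sq_le_sq₀ (norm_nonneg _) (by positivity), norm_stepIntegral_apply_sq, mul_pow,
    ← P.scalarMeasure_real_univ x]
  refine (Real.le_norm_self _).trans (norm_integral_le_of_norm_le_const (.of_forall fun z => ?_))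
  rw [norm_pow, norm_norm]
  gcongr
  exact hh z

end StepIntegral

section NormIntegral

variable {P : SpectralMeasure Ω H} {f g : Ω → ℂ} {a b : H →L[ℂ] H}

theorem IsNormIntegral.tendsto_stepIntegral (ha : P.IsNormIntegral f a) {ι : Type*} {l : Filter ι}
    {h : ι → SimpleFunc Ω ℂ} (hh : TendstoUniformly (fun n => ⇑(h n)) f l) :
    Tendsto (fun n => P.stepIntegral (h n)) l (𝓝 a) := by
  refine Metric.tendsto_nhds.2 fun ε hε => ?_
  filter_upwards [Metric.tendstoUniformly_iff.1 hh (ε / 2) (half_pos hε)] with n hn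
  rw [dist_eq_norm']
  refine (ha.2.2 (h n)).trans_lt (lt_of_le_of_lt ?_ (half_lt_self hε))
  exact Real.iSup_le (fun z => by rw [← dist_eq_norm]; exact (hn z).le) (half_pos hε).le

theorem isNormIntegral_of_tendsto_stepIntegral {h : ℕ → SimpleFunc Ω ℂ}
    (hh : TendstoUniformly (fun n => ⇑(h n)) f atTop)
    (ha : Tendsto (fun n => P.stepIntegral (h n)) atTop (𝓝 a)) : P.IsNormIntegral f a := by
  have hf := bddAbove_range_norm_of_tendstoUniformly hh fun n =>
    (h n).exists_forall_norm_le.imp fun _ => Set.forall_mem_range.2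
  refine ⟨measurable_of_tendsto_metrizable (fun n => (h n).measurable)
    (tendsto_pi_nhds.2 hh.tendsto_at), hf, fun k => ?_⟩
  obtain ⟨C, hC⟩ := hf
  obtain ⟨D, hD⟩ := k.exists_forall_norm_le
  have hbdd : BddAbove (Set.range fun z => ‖f z - k z‖) :=
    ⟨C + D, Set.forall_mem_range.2 fun z => norm_sub_le_of_le (hC ⟨z, rfl⟩) (hD z)⟩
  refine le_of_forall_pos_le_add fun ε hε => le_of_tendsto (ha.sub_const _).norm ?_
  filter_upwards [Metric.tendstoUniformly_iff.1 hh ε hε] with n hn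
  rw [← stepIntegral_sub]
  refine P.norm_stepIntegral_le (add_nonneg (Real.iSup_nonneg fun _ => norm_nonneg _) hε.le)
    fun z => ?_
  rw [SimpleFunc.coe_sub, Pi.sub_apply, ← sub_add_sub_cancel' (f z)]
  exact norm_add_le_of_le (le_ciSup hbdd z) (by rw [← dist_eq_norm']; exact (hn z).le)

theorem IsNormIntegral.exists_tendsto_stepIntegral (ha : P.IsNormIntegral f a) :
    ∃ h : ℕ → SimpleFunc Ω ℂ, TendstoUniformly (fun n => ⇑(h n)) f atTop ∧
      Tendsto (fun n => P.stepIntegral (h n)) atTop (𝓝 a) :=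
  have ⟨h, hh⟩ := exists_simpleFunc_tendstoUniformly ha.1 ha.2.1
  ⟨h, hh, ha.tendsto_stepIntegral hh⟩

theorem IsNormIntegral.unique (ha : P.IsNormIntegral f a) (hb : P.IsNormIntegral f b) : a = b :=
  have ⟨_, hh⟩ := exists_simpleFunc_tendstoUniformly ha.1 ha.2.1
  tendsto_nhds_unique (ha.tendsto_stepIntegral hh) (hb.tendsto_stepIntegral hh)

theorem exists_isNormIntegral (P : SpectralMeasure Ω H) (hf : Measurable f)
    (hb : BddAbove (Set.range fun z => ‖f z‖)) : ∃ a, P.IsNormIntegral f a := by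
  obtain ⟨h, hh⟩ := exists_simpleFunc_tendstoUniformly hf hb
  suffices hcauchy : CauchySeq fun n => P.stepIntegral (h n) from
    (cauchySeq_tendsto_of_complete hcauchy).imp fun a => isNormIntegral_of_tendsto_stepIntegral hh
  refine Metric.cauchySeq_iff.2 fun ε hε => ?_
  obtain ⟨N, hN⟩ := eventually_atTop.1 (Metric.tendstoUniformly_iff.1 hh (ε / 3) (by positivity))
  refine ⟨N, fun m hm n hn => ?_⟩
  rw [dist_eq_norm, ← stepIntegral_sub]
  refine (P.norm_stepIntegral_le (C := ε / 3 + ε / 3) (by positivity) fun z => ?_).trans_lt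
    (by linarith)
  rw [SimpleFunc.coe_sub, Pi.sub_apply, ← dist_eq_norm]
  exact (dist_triangle_left _ _ (f z)).trans (add_le_add (hN m hm z).le (hN n hn z).le)

theorem isNormIntegral_const (P : SpectralMeasure Ω H) (c : ℂ) :
    P.IsNormIntegral (fun _ => c) (c • 1) :=
  isNormIntegral_of_tendsto_stepIntegral (h := fun _ => SimpleFunc.const Ω c)
    (Metric.tendstoUniformly_iff.2 fun ε hε => by simp [hε])
    (by simp only [stepIntegral_const, tendsto_const_nhds])

theorem IsNormIntegral.add (ha : P.IsNormIntegral f a) (hb : P.IsNormIntegral g b) :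
    P.IsNormIntegral (fun z => f z + g z) (a + b) := by
  obtain ⟨h, hh, hha⟩ := ha.exists_tendsto_stepIntegral
  obtain ⟨k, hk, hkb⟩ := hb.exists_tendsto_stepIntegral
  refine isNormIntegral_of_tendsto_stepIntegral (h := fun n => h n + k n) (hh.add hk) ?_
  simpa only [stepIntegral_add] using hha.add hkb

theorem IsNormIntegral.mul (ha : P.IsNormIntegral f a) (hb : P.IsNormIntegral g b) :
    P.IsNormIntegral (fun z => f z * g z) (a * b) := by
  obtain ⟨h, hh, hha⟩ := ha.exists_tendsto_stepIntegral
  obtain ⟨k, hk, hkb⟩ := hb.exists_tendsto_stepIntegral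
  refine isNormIntegral_of_tendsto_stepIntegral (h := fun n => h n * k n)
    (tendstoUniformly_mul_of_bddAbove hh hk ha.2.1 hb.2.1) ?_
  simpa only [stepIntegral_mul] using hha.mul hkb

theorem IsNormIntegral.star (ha : P.IsNormIntegral f a) :
    P.IsNormIntegral (fun z => conj (f z)) (star a) := by
  obtain ⟨h, hh, hha⟩ := ha.exists_tendsto_stepIntegral
  refine isNormIntegral_of_tendsto_stepIntegral (h := fun n => (h n).map conj)
    (Complex.isometry_conj.uniformContinuous.comp_tendstoUniformly hh) ?_
  simpa only [stepIntegral_map_conj] using hha.star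

theorem IsNormIntegral.inner_apply (ha : P.IsNormIntegral f a) (x : H) :
    ⟪x, a x⟫_ℂ = ∫ z, f z ∂P.scalarMeasure x := by
  obtain ⟨h, hh, hha⟩ := ha.exists_tendsto_stepIntegral
  obtain ⟨C, hC⟩ := ha.2.1
  have hinner : Tendsto (fun n => ⟪x, P.stepIntegral (h n) x⟫_ℂ) atTop (𝓝 ⟪x, a x⟫_ℂ) :=
    ((continuous_const.inner (ContinuousLinearMap.apply ℂ H x).continuous).tendsto a).comp hha
  have hintegral : Tendsto (fun n => ∫ z, h n z ∂P.scalarMeasure x) atTop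
      (𝓝 (∫ z, f z ∂P.scalarMeasure x)) :=
    tendsto_integral_filter_of_dominated_convergence (fun _ => C + 1)
      (.of_forall fun n => (h n).aestronglyMeasurable)
      ((eventually_forall_norm_le_of_tendstoUniformly hh fun z => hC ⟨z, rfl⟩).mono
        fun _ hn => .of_forall hn)
      (integrable_const _) (.of_forall hh.tendsto_at)
  simp only [inner_stepIntegral_apply] at hinner
  exact tendsto_nhds_unique hinner hintegral

theorem IsNormIntegral.eq_zero_of_forall_notMem (ha : P.IsNormIntegral f a) {s : Set Ω}
    (hs : MeasurableSet s) (hPs : P s = 0) (hf : ∀ z ∉ s, f z = 0) : a = 0 :=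
  eq_of_forall_inner_apply_eq fun x => by
    have hμ : P.scalarMeasure x s = 0 := by simp [scalarMeasure_apply _ _ hs, hPs]
    have hae : f =ᵐ[P.scalarMeasure x] 0 := by
      filter_upwards [measure_eq_zero_iff_ae_notMem.1 hμ] with z hz using hf z hz
    rw [ha.inner_apply, integral_eq_zero_of_ae hae, zero_apply, inner_zero_right]

theorem IsNormIntegral.centralizer_operators_subset (ha : P.IsNormIntegral f a) :
    Set.centralizer P.operators ⊆ Set.centralizer {a} := by
  rintro c hc _ rfl
  obtain ⟨h, -, hha⟩ := ha.exists_tendsto_stepIntegral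
  have hcommute (n : ℕ) : P.stepIntegral (h n) * c = c * P.stepIntegral (h n) :=
    (Commute.sum_left _ _ _ fun α _ =>
      Commute.smul_left (hc _ ⟨_, (h n).measurableSet_fiber α, rfl⟩) α).eq
  exact tendsto_nhds_unique (hha.mul_const c)
    (by simpa only [hcommute] using hha.const_mul c)

end NormIntegral

section IntegralHom

variable {X : Type*} [TopologicalSpace X] [CompactSpace X] [MeasurableSpace X]
  [OpensMeasurableSpace X]

theorem exists_isNormIntegral_continuousMap (P : SpectralMeasure X H) (f : C(X, ℂ)) :
    ∃ a, P.IsNormIntegral f a :=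
  P.exists_isNormIntegral f.continuous.measurable (isCompact_range f.continuous.norm).bddAbove

/-- The representation `f ↦ ∫ f dP` of `C(X, ℂ)` defined by a spectral measure `P`. -/
def integralHom (P : SpectralMeasure X H) : C(X, ℂ) →⋆ₐ[ℂ] (H →L[ℂ] H) :=
  have hint f := (P.exists_isNormIntegral_continuousMap f).choose_spec
  have hconst c : (P.exists_isNormIntegral_continuousMap (.const X c)).choose = c • 1 :=
    (hint _).unique (P.isNormIntegral_const c)
  { toFun f := (P.exists_isNormIntegral_continuousMap f).choose
    map_zero' := (hconst 0).trans (zero_smul _ _)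
    map_one' := (hconst 1).trans (one_smul _ _)
    map_add' f g := (hint _).unique ((hint f).add (hint g))
    map_mul' f g := (hint _).unique ((hint f).mul (hint g))
    map_star' f := (hint _).unique (hint f).star
    commutes' c := (hconst c).trans (Algebra.algebraMap_eq_smul_one c).symm }

theorem isNormIntegral_integralHom (P : SpectralMeasure X H) (f : C(X, ℂ)) :
    P.IsNormIntegral f (P.integralHom f) :=
  (P.exists_isNormIntegral_continuousMap f).choose_spec

end IntegralHom

end SpectralMeasure

namespace SpectralMeasure

variable {H : Type*} [NormedAddCommGroup H] [InnerProductSpace ℂ H] [CompleteSpace H]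
  {X : Type*} [TopologicalSpace X]

section RepresentingMeasure

/-- The complex-valued continuous function underlying a real-valued one. It serves to test
representations of `C(X, ℂ)` against the real-valued functions of the Riesz–Markov–Kakutani
theorem. -/
def ofRealMap : C(X, ℝ) →L[ℝ] C(X, ℂ) := Complex.ofRealCLM.compLeftContinuous ℝ X

@[simp]
theorem ofRealMap_apply (f : C(X, ℝ)) (z : X) : ofRealMap f z = (f z : ℂ) := rfl

theorem inner_integralHom_ofRealMap [CompactSpace X] [MeasurableSpace X] [OpensMeasurableSpace X]
    (P : SpectralMeasure X H) (f : C(X, ℝ)) (x : H) :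
    ⟪x, P.integralHom (ofRealMap f) x⟫_ℂ = ((∫ z, f z ∂P.scalarMeasure x : ℝ) : ℂ) := by
  rw [(P.isNormIntegral_integralHom _).inner_apply, ← integral_complex_ofReal]
  rfl

theorem inner_map_star_mul_self_apply (Φ : C(X, ℂ) →⋆ₐ[ℂ] (H →L[ℂ] H)) (g : C(X, ℂ)) (x : H) :
    ⟪x, Φ (star g * g) x⟫_ℂ = ((‖Φ g x‖ ^ 2 : ℝ) : ℂ) := by
  rw [map_mul, map_star, inner_star_mul_self_apply]

theorem re_inner_map_ofRealMap_nonneg (Φ : C(X, ℂ) →⋆ₐ[ℂ] (H →L[ℂ] H)) {f : C(X, ℝ)}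
    (hf : ∀ z, 0 ≤ f z) (x : H) : 0 ≤ (⟪x, Φ (ofRealMap f) x⟫_ℂ).re := by
  let g : C(X, ℂ) := ofRealMap ⟨fun z => √(f z), by fun_prop⟩
  have hg : ofRealMap f = star g * g := by
    ext z
    simp [g, ← Complex.ofReal_mul, Real.mul_self_sqrt (hf z)]
  rw [hg, inner_map_star_mul_self_apply, Complex.ofReal_re]
  positivity

variable [CompactSpace X]

/-- The positive functional `f ↦ ⟨Φ f x, x⟩` on the real-valued functions, whose
Riesz–Markov–Kakutani measure becomes the scalar measure of the representation `Φ` at `x`. -/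
def positiveFunctional (Φ : C(X, ℂ) →⋆ₐ[ℂ] (H →L[ℂ] H)) (x : H) : C_c(X, ℝ) →ₚ[ℝ] ℝ :=
  PositiveLinearMap.mk₀
    { toFun f := (⟪x, Φ (ofRealMap f.toContinuousMap) x⟫_ℂ).re
      map_add' f g := by
        have hadd : (f + g).toContinuousMap = f.toContinuousMap + g.toContinuousMap := rfl
        rw [hadd, map_add, map_add, add_apply, inner_add_right, Complex.add_re]
      map_smul' c f := by
        have hsmul : ofRealMap (c • f).toContinuousMap = (c : ℂ) • ofRealMap f.toContinuousMap := by
          ext z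
          simp
        rw [hsmul, map_smul, smul_apply, inner_smul_right, Complex.re_ofReal_mul]
        rfl }
    fun _ hf => re_inner_map_ofRealMap_nonneg Φ hf x

variable [T2Space X] [MeasurableSpace X] [BorelSpace X]

/-- The measure representing the functional `f ↦ ⟨Φ f x, x⟩` on `C(X, ℂ)`. -/
def representingMeasure (Φ : C(X, ℂ) →⋆ₐ[ℂ] (H →L[ℂ] H)) (x : H) : Measure X :=
  RealRMK.rieszMeasure (positiveFunctional Φ x)

instance (Φ : C(X, ℂ) →⋆ₐ[ℂ] (H →L[ℂ] H)) (x : H) : (representingMeasure Φ x).Regular :=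
  RealRMK.regular_rieszMeasure _

instance (Φ : C(X, ℂ) →⋆ₐ[ℂ] (H →L[ℂ] H)) (x : H) : IsFiniteMeasure (representingMeasure Φ x) :=
  inferInstanceAs (IsFiniteMeasure (RealRMK.rieszMeasure _))

theorem integral_representingMeasure (Φ : C(X, ℂ) →⋆ₐ[ℂ] (H →L[ℂ] H)) (x : H) (f : C(X, ℝ)) :
    ∫ z, f z ∂representingMeasure Φ x = (⟪x, Φ (ofRealMap f) x⟫_ℂ).re :=
  RealRMK.integral_rieszMeasure (positiveFunctional Φ x) ⟨f, .of_compactSpace _⟩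

theorem integral_norm_sq_representingMeasure (Φ : C(X, ℂ) →⋆ₐ[ℂ] (H →L[ℂ] H)) (x : H)
    (g : C(X, ℂ)) : ∫ z, ‖g z‖ ^ 2 ∂representingMeasure Φ x = ‖Φ g x‖ ^ 2 := by
  let f : C(X, ℝ) := ⟨fun z => ‖g z‖ ^ 2, by fun_prop⟩
  have hf : ofRealMap f = star g * g := by
    ext z
    simp [f, Complex.conj_mul']
  calc ∫ z, ‖g z‖ ^ 2 ∂representingMeasure Φ x = (⟪x, Φ (ofRealMap f) x⟫_ℂ).re :=
        integral_representingMeasure Φ x f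
    _ = ‖Φ g x‖ ^ 2 := by rw [hf, inner_map_star_mul_self_apply, Complex.ofReal_re]

theorem norm_toLp_representingMeasure (Φ : C(X, ℂ) →⋆ₐ[ℂ] (H →L[ℂ] H)) (x : H) (g : C(X, ℂ)) :
    ‖ContinuousMap.toLp 2 (representingMeasure Φ x) ℂ g‖ = ‖Φ g x‖ := by
  rw [← sq_eq_sq₀ (norm_nonneg _) (norm_nonneg _), ← integral_norm_sq_representingMeasure,
    ← inner_self_eq_norm_sq (𝕜 := ℂ), ContinuousMap.inner_toLp]
  simp only [Complex.mul_conj']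
  norm_cast

end RepresentingMeasure

section CyclicIsometry

/-- The orbit map `g ↦ Φ g x`. -/
def orbitMap (Φ : C(X, ℂ) →⋆ₐ[ℂ] (H →L[ℂ] H)) (x : H) : C(X, ℂ) →ₗ[ℂ] H :=
  (ContinuousLinearMap.apply ℂ H x).toLinearMap ∘ₗ Φ.toAlgHom.toLinearMap

variable [CompactSpace X] [T2Space X] [MeasurableSpace X] [BorelSpace X]

/-- The continuous extension to `L²` of the orbit map `g ↦ Φ g x`. -/
def cyclicMap (Φ : C(X, ℂ) →⋆ₐ[ℂ] (H →L[ℂ] H)) (x : H) :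
    Lp ℂ 2 (representingMeasure Φ x) →L[ℂ] H :=
  (orbitMap Φ x).extendOfNorm (ContinuousMap.toLp 2 (representingMeasure Φ x) ℂ).toLinearMap

theorem cyclicMap_toLp (Φ : C(X, ℂ) →⋆ₐ[ℂ] (H →L[ℂ] H)) (x : H) (g : C(X, ℂ)) :
    cyclicMap Φ x (ContinuousMap.toLp 2 (representingMeasure Φ x) ℂ g) = Φ g x :=
  LinearMap.extendOfNorm_eq (f := orbitMap Φ x)
    (e := (ContinuousMap.toLp 2 (representingMeasure Φ x) ℂ).toLinearMap)
    (ContinuousMap.toLp_denseRange ℂ _ ℂ ENNReal.ofNat_ne_top)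
    ⟨1, fun g => by rw [one_mul]; exact (norm_toLp_representingMeasure Φ x g).ge⟩ g

/-- The isometry from `L²` onto the cyclic subspace generated by `x` which extends the orbit map
`g ↦ Φ g x`. It carries multiplication by functions on `L²` to the representation `Φ`. -/
def cyclicIsometry (Φ : C(X, ℂ) →⋆ₐ[ℂ] (H →L[ℂ] H)) (x : H) :
    Lp ℂ 2 (representingMeasure Φ x) →ₗᵢ[ℂ] H where
  toLinearMap := (cyclicMap Φ x).toLinearMap
  norm_map' v := by
    refine (ContinuousMap.toLp_denseRange (p := 2) ℂ (representingMeasure Φ x) ℂ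
      ENNReal.ofNat_ne_top).induction_on (p := fun v => ‖cyclicMap Φ x v‖ = ‖v‖) v
      (isClosed_eq (by fun_prop) (by fun_prop)) fun g => ?_
    rw [cyclicMap_toLp, norm_toLp_representingMeasure]

theorem cyclicIsometry_toLp (Φ : C(X, ℂ) →⋆ₐ[ℂ] (H →L[ℂ] H)) (x : H) (g : C(X, ℂ)) :
    cyclicIsometry Φ x (ContinuousMap.toLp 2 (representingMeasure Φ x) ℂ g) = Φ g x :=
  cyclicMap_toLp Φ x g

theorem inner_map_apply_eq_integral (Φ : C(X, ℂ) →⋆ₐ[ℂ] (H →L[ℂ] H)) (x : H) (g : C(X, ℂ)) :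
    ⟪x, Φ g x⟫_ℂ = ∫ z, g z ∂representingMeasure Φ x := by
  have hone : cyclicIsometry Φ x (ContinuousMap.toLp 2 _ ℂ 1) = x := by
    rw [cyclicIsometry_toLp, map_one, one_apply_eq_self]
  nth_rw 1 [← hone]
  rw [← cyclicIsometry_toLp, LinearIsometry.inner_map_map, ContinuousMap.inner_toLp]
  simp

end CyclicIsometry

section Projections

variable [CompactSpace X] [T2Space X] [MeasurableSpace X] [BorelSpace X]
  (Φ : C(X, ℂ) →⋆ₐ[ℂ] (H →L[ℂ] H)) {s t : Set X}

/-- The function underlying the spectral projection `proj Φ hs`: the image of the indicator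
function of `s` under the isometry `cyclicIsometry Φ x`, which depends on `x`. -/
def projFun (hs : MeasurableSet s) (x : H) : H :=
  cyclicIsometry Φ x (indicatorConstLp 2 hs (measure_ne_top _ _) 1)

theorem inner_projFun_projFun (hs : MeasurableSet s) (ht : MeasurableSet t) (x : H) :
    ⟪projFun Φ hs x, projFun Φ ht x⟫_ℂ =
      (((representingMeasure Φ x).real (s ∩ t) : ℝ) : ℂ) := by
  rw [projFun, projFun, LinearIsometry.inner_map_map,
    L2.inner_indicatorConstLp_one_indicatorConstLp_one]
  rfl

theorem norm_projFun_sq (hs : MeasurableSet s) (x : H) :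
    ‖projFun Φ hs x‖ ^ 2 = (representingMeasure Φ x).real s := by
  rw [← inner_self_eq_norm_sq (𝕜 := ℂ), inner_projFun_projFun, Set.inter_self]
  exact Complex.ofReal_re _

theorem projFun_univ (x : H) : projFun Φ MeasurableSet.univ x = x := by
  have hone : indicatorConstLp 2 MeasurableSet.univ
      (measure_ne_top (representingMeasure Φ x) _) (1 : ℂ) = ContinuousMap.toLp 2 _ ℂ 1 := by
    rw [indicatorConstLp_univ]
    rfl
  rw [projFun, hone, cyclicIsometry_toLp, map_one, one_apply_eq_self]

theorem inner_projFun (hs : MeasurableSet s) (x : H) :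
    ⟪x, projFun Φ hs x⟫_ℂ = ((‖projFun Φ hs x‖ ^ 2 : ℝ) : ℂ) := by
  nth_rw 1 [← projFun_univ Φ x]
  rw [inner_projFun_projFun, Set.univ_inter, norm_projFun_sq]

theorem norm_projFun_le (hs : MeasurableSet s) (x : H) : ‖projFun Φ hs x‖ ≤ ‖x‖ := by
  rw [← sq_le_sq₀ (norm_nonneg _) (norm_nonneg _)]
  nth_rw 2 [← projFun_univ Φ x]
  rw [norm_projFun_sq, norm_projFun_sq]
  exact measureReal_mono (Set.subset_univ s)

theorem exists_norm_projFun_sub_le (hs : MeasurableSet s) (F : Finset H) {ε : ℝ} (hε : 0 < ε) :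
    ∃ g : C(X, ℂ), ∀ x ∈ F, ‖projFun Φ hs x - Φ g x‖ ≤ ε := by
  -- A single `g` serves all `x ∈ F` when it approximates the indicator function of `s` in the
  -- `L²` space of the sum of the representing measures.
  have hmem : MemLp (s.indicator fun _ => (1 : ℂ)) 2 (∑ x ∈ F, representingMeasure Φ x) :=
    memLp_indicator_const 2 hs 1 (Or.inr (measure_ne_top _ _))
  obtain ⟨g, hg, -⟩ := hmem.exists_boundedContinuous_eLpNorm_sub_le ENNReal.ofNat_ne_top
    (ENNReal.ofReal_pos.2 hε).ne'
  refine ⟨g.toContinuousMap, fun x hx => ?_⟩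
  have hle : representingMeasure Φ x ≤ ∑ x ∈ F, representingMeasure Φ x :=
    Finset.single_le_sum (f := representingMeasure Φ) (fun _ _ => Measure.zero_le _) hx
  rw [projFun, ← cyclicIsometry_toLp, ← map_sub, LinearIsometry.norm_map, Lp.norm_def]
  refine ENNReal.toReal_le_of_le_ofReal hε.le (le_trans ?_ hg)
  refine (eLpNorm_congr_ae ?_).trans_le (eLpNorm_mono_measure _ hle)
  exact (Lp.coeFn_sub _ _).trans (indicatorConstLp_coeFn.sub (ContinuousMap.coeFn_toLp _ _))

theorem projFun_mem_closure_range (hs : MeasurableSet s) :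
    projFun Φ hs ∈ closure (Set.range fun g : C(X, ℂ) => (Φ g : H → H)) := by
  choose g hg using fun p : Finset H × ℕ =>
    exists_norm_projFun_sub_le Φ hs p.1 (Nat.one_div_pos_of_nat (α := ℝ) (n := p.2))
  refine mem_closure_of_tendsto (b := atTop ×ˢ atTop) (f := fun p => (Φ (g p) : H → H))
    (tendsto_pi_nhds.2 fun x => ?_) (.of_forall fun p => Set.mem_range_self (g p))
  refine tendsto_iff_norm_sub_tendsto_zero.2 (squeeze_zero' (.of_forall fun _ => norm_nonneg _) ?_
    (tendsto_one_div_add_atTop_nhds_zero_nat.comp tendsto_snd))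
  filter_upwards [tendsto_fst.eventually (eventually_ge_atTop {x})] with p hp
  rw [norm_sub_rev]
  exact hg p x (hp (Finset.mem_singleton_self x))

/-- The spectral projection at `s` of the representation `Φ`. As a pointwise limit of the operators
`Φ g`, the function `projFun Φ hs` is linear. -/
def proj (hs : MeasurableSet s) : H →L[ℂ] H :=
  have hrange : Set.range (fun g => (Φ g : H → H)) ⊆ Set.range ((⇑) : (H →ₗ[ℂ] H) → H → H) :=
    Set.range_subset_iff.2 fun g => ⟨(Φ g).toLinearMap, rfl⟩
  (linearMapOfMemClosureRangeCoe (σ := .id ℂ) _ <|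
    closure_mono hrange (projFun_mem_closure_range Φ hs)).mkContinuous 1 fun x => by
    rw [one_mul]
    exact norm_projFun_le Φ hs x

theorem proj_apply (hs : MeasurableSet s) (x : H) : proj Φ hs x = projFun Φ hs x := rfl

theorem isStarProjection_proj (hs : MeasurableSet s) : IsStarProjection (proj Φ hs) :=
  isStarProjection_of_forall_inner_apply_eq (inner_projFun Φ hs)

theorem commute_proj (hs : MeasurableSet s) {a : H →L[ℂ] H} (ha : ∀ g, Commute (Φ g) a) :
    Commute (proj Φ hs) a := by
  ext x
  have hclosed : IsClosed {f : H → H | f (a x) = a (f x)} := isClosed_eq (by fun_prop) (by fun_prop)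
  refine closure_minimal (Set.range_subset_iff.2 fun g => ?_) hclosed
    (projFun_mem_closure_range Φ hs)
  exact congrArg (fun T : H →L[ℂ] H => T x) (ha g).eq

open scoped Classical in
/-- The spectral measure of the representation `Φ` of `C(X, ℂ)`, so that `Φ f = ∫ f dP` for all
continuous `f`. -/
def ofStarAlgHom : SpectralMeasure X H where
  toFun s := if hs : MeasurableSet s then proj Φ hs else 0
  not_measurable s hs := dif_neg hs
  isStarProjection s hs := by rw [dif_pos hs]; exact isStarProjection_proj Φ hs
  univ := by
    rw [dif_pos MeasurableSet.univ]
    ext x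
    exact projFun_univ Φ x
  hasSum_iUnion x s hs hd := by
    simp only [dif_pos (hs _), dif_pos (MeasurableSet.iUnion hs), proj_apply, norm_projFun_sq]
    rw [Measure.real, measure_iUnion hd hs, ENNReal.tsum_toReal_eq fun i => measure_ne_top _ _]
    exact ENNReal.hasSum_toReal (measure_iUnion (μ := representingMeasure Φ x) hd hs ▸
      measure_ne_top _ _)

theorem ofStarAlgHom_apply (hs : MeasurableSet s) : ofStarAlgHom Φ s = proj Φ hs := dif_pos hs

theorem scalarMeasure_ofStarAlgHom (x : H) :
    (ofStarAlgHom Φ).scalarMeasure x = representingMeasure Φ x := by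
  ext s hs
  rw [scalarMeasure_apply _ _ hs, ofStarAlgHom_apply Φ hs, proj_apply, norm_projFun_sq,
    ofReal_measureReal]

theorem integralHom_ofStarAlgHom : (ofStarAlgHom Φ).integralHom = Φ := by
  ext1 g
  refine eq_of_forall_inner_apply_eq fun x => ?_
  rw [((ofStarAlgHom Φ).isNormIntegral_integralHom g).inner_apply, scalarMeasure_ofStarAlgHom,
    inner_map_apply_eq_integral]

end Projections

end SpectralMeasure

namespace ResolutionOfIdentity

variable {H : Type*} [NormedAddCommGroup H] [InnerProductSpace ℂ H] [CompleteSpace H]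
  {X : Type*} [TopologicalSpace X] [CompactSpace X] [T2Space X] [MeasurableSpace X] [BorelSpace X]

/-- The resolution of identity of a representation `Φ` of `C(X, ℂ)`. -/
def ofStarAlgHom (Φ : C(X, ℂ) →⋆ₐ[ℂ] (H →L[ℂ] H)) : ResolutionOfIdentity X H where
  toSpectralMeasure := SpectralMeasure.ofStarAlgHom Φ
  innerRegular x := by
    rw [SpectralMeasure.scalarMeasure_ofStarAlgHom]
    infer_instance

theorem eq_of_integralHom_eq {P Q : ResolutionOfIdentity X H}
    (h : P.integralHom = Q.integralHom) : P = Q := by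
  refine ResolutionOfIdentity.ext <| congrArg SpectralMeasure.toFun <|
    SpectralMeasure.ext_scalarMeasure fun x => ?_
  have := P.innerRegular x
  have := Q.innerRegular x
  refine Measure.ext_of_integral_eq_on_compactlySupported fun f => Complex.ofReal_injective ?_
  have hinner := congrArg (fun Φ => ⟪x, Φ (SpectralMeasure.ofRealMap f.toContinuousMap) x⟫_ℂ) h
  simp only [SpectralMeasure.inner_integralHom_ofRealMap] at hinner
  exact hinner

/-- Resolutions of identity on a compact Hausdorff space `X` are the same as representations of
`C(X, ℂ)`, a resolution of identity `P` corresponding to `f ↦ ∫ f dP`. -/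
def equivStarAlgHom : ResolutionOfIdentity X H ≃ (C(X, ℂ) →⋆ₐ[ℂ] (H →L[ℂ] H)) where
  toFun P := P.integralHom
  invFun := ofStarAlgHom
  left_inv _ := eq_of_integralHom_eq (SpectralMeasure.integralHom_ofStarAlgHom _)
  right_inv := SpectralMeasure.integralHom_ofStarAlgHom

theorem centralizer_operators (P : ResolutionOfIdentity X H) :
    Set.centralizer P.operators = Set.centralizer (Set.range P.integralHom) := by
  refine Set.Subset.antisymm ?_ fun a ha => ?_
  · rintro a ha _ ⟨f, rfl⟩
    exact (P.isNormIntegral_integralHom f).centralizer_operators_subset ha _ rfl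
  · rintro _ ⟨s, hs, rfl⟩
    have hproj : P.toSpectralMeasure s = SpectralMeasure.proj P.integralHom hs := by
      rw [← SpectralMeasure.ofStarAlgHom_apply]
      exact congrArg (·.toSpectralMeasure s) (equivStarAlgHom.symm_apply_apply P).symm
    rw [hproj]
    exact SpectralMeasure.commute_proj _ hs fun f => ha _ ⟨f, rfl⟩

theorem hasSupport_univ (P : ResolutionOfIdentity X H) (hP : Injective P.integralHom) :
    P.HasSupport Set.univ := by
  refine ⟨∅, ⟨⟨isOpen_empty, P.empty⟩, fun U ⟨hU, hPU⟩ z hz => ?_⟩, Set.compl_empty.symm⟩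
  obtain ⟨f, hfU, hfz, -⟩ := exists_continuous_zero_one_of_isClosed hU.isClosed_compl
    (isClosed_singleton (x := z)) (Set.disjoint_singleton_right.2 fun hzU => hzU hz)
  have hf : SpectralMeasure.ofRealMap f = 0 := hP <| by
    rw [map_zero]
    exact (P.isNormIntegral_integralHom _).eq_zero_of_forall_notMem hU.measurableSet hPU
      fun w hw => by simp [hfU hw]
  simpa [hfz (Set.mem_singleton z)] using DFunLike.congr_fun hf z

end ResolutionOfIdentity

section Normal

variable {H : Type*} [NormedAddCommGroup H] [InnerProductSpace ℂ H] [CompleteSpace H]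
  {b : H →L[ℂ] H}

open scoped CStarAlgebra in
theorem SpectralMeasure.isNormIntegral_coe_iff (hb : IsStarNormal b)
    (P : SpectralMeasure (spectrum ℂ b) H) :
    P.IsNormIntegral (fun z => (z : ℂ)) b ↔ P.integralHom = cfcHom hb := by
  have hid := P.isNormIntegral_integralHom (.restrict (spectrum ℂ b) (.id ℂ))
  refine ⟨fun h => ?_, fun h => ?_⟩
  · exact (cfcHom_eq_of_continuous_of_map_id hb _ (map_continuous _) (hid.unique h)).symm
  · rwa [h, cfcHom_id hb] at hid

theorem centralizer_range_cfcHom (hb : IsStarNormal b) :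
    Set.centralizer (Set.range (cfcHom (R := ℂ) hb)) = Set.centralizer {b} := by
  refine Set.Subset.antisymm (Set.centralizer_subset ?_) ?_
  · exact Set.singleton_subset_iff.2 ⟨_, cfcHom_id hb⟩
  · rintro a ha _ ⟨f, rfl⟩
    have hba : Commute b a := ha b rfl
    exact hba.cfcHom hb (hb.commute_star_left hba) f

end Normal

end

theorem mainTheorem9 {H : Type*} [NormedAddCommGroup H] [InnerProductSpace ℂ H] [CompleteSpace H]
    [Nontrivial H] (b : H →L[ℂ] H) (hb : IsStarNormal b) :
    (∃! P : ResolutionOfIdentity (spectrum ℂ b) H,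
      P.toSpectralMeasure.IsNormIntegral (fun z : spectrum ℂ b => (z : ℂ)) b) ∧
    ∀ P : ResolutionOfIdentity (spectrum ℂ b) H,
      P.toSpectralMeasure.IsNormIntegral (fun z : spectrum ℂ b => (z : ℂ)) b →
        Set.centralizer {b} = Set.centralizer P.toSpectralMeasure.operators ∧
        P.HasSupport Set.univ := by
  simp only [SpectralMeasure.isNormIntegral_coe_iff hb]
  refine ⟨ResolutionOfIdentity.equivStarAlgHom.bijective.existsUnique (cfcHom hb),
    fun P hP => ⟨?_, ?_⟩⟩
  · rw [P.centralizer_operators, hP, centralizer_range_cfcHom]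
  · exact P.hasSupport_univ (hP ▸ cfcHom_injective hb)
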